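/- Let $E$ be a field. For $n\ge 1$ put $K_n=E((t^{-1/n}))$ and $A_n=E[t^{1/n}]$, let $\tilde K=\bigcup_{n\ge1}K_n$ be the Puiseux field with its valuation $\nu$ normalized by $\nu(t^{-1/n})=1/n$ and $\nu|_{E^*}=0$ (so $\nu(0)=\infty$), let $\hat K$ be the completion of $\tilde K$ with the extended valuation $\nu$, and let $\bar A=\bigcup_{n\ge1}A_n$ be the ring of Puiseux polynomials. Let $\mathbb H^{\mathrm{Berk}}_{\mathbb R}=(\hat K\times\mathbb R)/\!\sim$, where $(a,r)\sim(a',r')$ if and only if $r=r'$ and $\nu(a-a')\ge r$, and write $\eta_{a,r}$ for the class of $(a,r)$; these are the points of type II and III of the Berkovich projective line over $\hat K$. The group $\mathrm{GL}_2(\hat K)$ acts on $\mathbb H^{\mathrm{Berk}}_{\mathbb R}$ by Möbius transformations: for $g=\begin{pmatrix}\alpha&\beta\\ \gamma&\delta\end{pmatrix}$ and $u=\gamma a+\delta$, $$g*\eta_{a,r}=\begin{cases}\eta_{(\alpha a+\beta)/u,\; r+\nu(\det g)-2\nu(u)},&\text{if }\nu(u)<\nu(\gamma)+r,\\ \eta_{\alpha/\gamma,\;\nu(\det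 g)-2\nu(\gamma)-r},&\text{if }\nu(u)\ge\nu(\gamma)+r,\end{cases}$$ and $\mathrm{SL}_2(\bar A)$ acts as a subgroup of $\mathrm{GL}_2(\hat K)$. Let $\mathscr R_\infty=\{\eta_{0,r}: r\le 0\}$ be the modular ray. Endow $\mathbb H^{\mathrm{Berk}}_{\mathbb R}$ either with the quotient topology of the product topology on $\hat K\times\mathbb R$, or with the topology of the metric $$d(\eta_{a,r},\eta_{a',r'})=\begin{cases}|r-r'|,&\text{if }\nu(a-a')\ge\min(r,r'),\\ r+r'-2\nu(a-a'),&\text{if }\nu(a-a')<\min(r,r').\end{cases}$$ In both cases give $\mathscr R_\infty$ the subspace topology and the orbit space $\mathrm{SL}_2(\bar A)\backslash\mathbb H^{\mathrm{Berk}}_{\mathbb R}$ the quotient topology. Then, for each of the two topologies, the canonical projection $\pi:\mathbb H^{\mathrm{Berk}}_{\mathbb R}\to\mathrm{SL}_2(\bar A)\backslash\mathbb H^{\mathrm{Berk}}_{\mathbb R}$ restricts to a homeomorphism $$\tilde\pi:\mathscr R_\infty\longrightarrow\mathrm{SL}_2(\bar A)\backslash\mathbb H^{\mathrm{Berk}}_{\mathbb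 R}.$$ -/

import Mathlib

open Topology
open scoped MatrixGroups HahnSeries

noncomputable section

namespace PuiseuxRay

/-! ### The Puiseux field, its completion, and the ring of Puiseux polynomials

Hahn series over `ℚ` are written in the variable `t⁻¹`, so that `HahnSeries.single q 1` stands for
`t ^ (-q)` and the order of a series is its valuation `ν`, with `ν (t⁻¹) = 1`. -/

section Field

variable (E : Type*) [Field E]

/-- The map `m ↦ m / n` from `ℤ` to `ℚ`. -/
def divHom (n : ℕ+) : ℤ →+ ℚ where
  toFun m := (m : ℚ) / (n : ℕ)
  map_zero' := by simp
  map_add' a b := by push_cast; ring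

theorem divHom_le_iff (n : ℕ+) (a b : ℤ) : divHom n a ≤ divHom n b ↔ a ≤ b := by
  have hn : (0 : ℚ) < (n : ℕ) := by exact_mod_cast n.pos
  simp only [divHom, AddMonoidHom.coe_mk, ZeroHom.coe_mk]
  rw [div_le_div_iff_of_pos_right hn, Int.cast_le]

theorem divHom_injective (n : ℕ+) : Function.Injective (divHom n) := fun a b h =>
  le_antisymm ((divHom_le_iff n a b).1 h.le) ((divHom_le_iff n b a).1 h.ge)

/-- The substitution of `t ^ (-1/n)` for the variable of a Laurent series. -/
def substRoot (n : ℕ+) : LaurentSeries E →+* E⟦ℚ⟧ :=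
  HahnSeries.embDomainRingHom (divHom n) (divHom_injective n) (divHom_le_iff n)

/-- `K_n = E((t ^ (-1/n)))`, as a field of Hahn series. -/
def laurentRoot (n : ℕ+) : Subfield E⟦ℚ⟧ := (substRoot E n).fieldRange

theorem laurentRoot_le_mul (m n : ℕ+) : laurentRoot E m ≤ laurentRoot E (m * n) := by
  rintro _ ⟨x, rfl⟩
  have hn : (0 : ℤ) < (n : ℕ) := by exact_mod_cast n.pos
  let f : ℤ ↪o ℤ := OrderEmbedding.ofStrictMono (fun k => k * (n : ℕ))
    (fun a b h => mul_lt_mul_of_pos_right h hn)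
  have hf : ∀ k, f k = k * (n : ℕ) := fun k => rfl
  have key : ∀ k, divHom (m * n) (f k) = divHom m k := by
    intro k
    have h1 : ((m : ℕ) : ℚ) ≠ 0 := by exact_mod_cast m.ne_zero
    have h2 : ((n : ℕ) : ℚ) ≠ 0 := by exact_mod_cast n.ne_zero
    rw [hf]
    simp only [divHom, AddMonoidHom.coe_mk, ZeroHom.coe_mk]
    push_cast
    field_simp
  refine ⟨HahnSeries.embDomain f x, ?_⟩
  simp only [substRoot, HahnSeries.embDomainRingHom_apply]
  ext q
  by_cases hq : q ∈ Set.range (divHom m)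
  · obtain ⟨k, rfl⟩ := hq
    rw [HahnSeries.embDomain_mk_coeff]
    rw [← key, HahnSeries.embDomain_mk_coeff, HahnSeries.embDomain_coeff]
  · rw [HahnSeries.embDomain_of_notMem_range (x := x) (by simpa using hq)]
    by_cases hq' : q ∈ Set.range (divHom (m * n))
    · obtain ⟨k, rfl⟩ := hq'
      rw [HahnSeries.embDomain_mk_coeff]
      apply HahnSeries.embDomain_of_notMem_range
      rintro ⟨l, rfl⟩
      exact hq ⟨l, (key l).symm⟩
    · rw [HahnSeries.embDomain_of_notMem_range (by simpa using hq')]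

/-- The Puiseux field `⋃ₙ E((t ^ (-1/n)))`. -/
def PuiseuxField : Subfield E⟦ℚ⟧ where
  carrier := {x | ∃ n : ℕ+, x ∈ laurentRoot E n}
  mul_mem' := by
    rintro a b ⟨m, hm⟩ ⟨n, hn⟩
    exact ⟨m * n, mul_mem (laurentRoot_le_mul E m n hm)
      (mul_comm m n ▸ laurentRoot_le_mul E n m hn)⟩
  add_mem' := by
    rintro a b ⟨m, hm⟩ ⟨n, hn⟩
    exact ⟨m * n, add_mem (laurentRoot_le_mul E m n hm)
      (mul_comm m n ▸ laurentRoot_le_mul E n m hn)⟩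
  zero_mem' := ⟨1, zero_mem _⟩
  one_mem' := ⟨1, one_mem _⟩
  neg_mem' := by
    rintro a ⟨n, hn⟩
    exact ⟨n, neg_mem hn⟩
  inv_mem' := by
    rintro a ⟨n, hn⟩
    exact ⟨n, inv_mem hn⟩

/-- The monomial `t ^ (1/n)` of the Puiseux field. -/
def tRoot (n : ℕ+) : PuiseuxField E :=
  ⟨HahnSeries.single (-1 / ((n : ℕ) : ℚ)) 1, n, HahnSeries.single (-1 : ℤ) 1, by
    rw [substRoot, HahnSeries.embDomainRingHom_apply, HahnSeries.embDomain_single]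
    simp [divHom]⟩

/-- The inclusion of the constants in the Puiseux field. -/
def constHom : E →+* PuiseuxField E :=
  (HahnSeries.C : E →+* E⟦ℚ⟧).codRestrict (PuiseuxField E) fun r =>
    ⟨1, HahnSeries.C r, by rw [substRoot, HahnSeries.embDomainRingHom_C]⟩

/-- `A_n = E[t ^ (1/n)]`. -/
def polyRoot (n : ℕ+) : Subring (PuiseuxField E) :=
  (Polynomial.eval₂RingHom (constHom E) (tRoot E n)).range

theorem tRoot_mul_pow (m n : ℕ+) : tRoot E (m * n) ^ (n : ℕ) = tRoot E m := by
  apply Subtype.ext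
  have h1 : ((m : ℕ) : ℚ) ≠ 0 := by exact_mod_cast m.ne_zero
  have h2 : ((n : ℕ) : ℚ) ≠ 0 := by exact_mod_cast n.ne_zero
  have h3 : ((n : ℕ) : ℚ) * (-1 / ((m * n : ℕ+) : ℕ)) = -1 / ((m : ℕ) : ℚ) := by
    push_cast
    field_simp
  change (HahnSeries.single (-1 / (((m * n : ℕ+) : ℕ) : ℚ)) (1 : E)) ^ (n : ℕ) =
    HahnSeries.single (-1 / ((m : ℕ) : ℚ)) 1
  rw [HahnSeries.single_pow, one_pow, nsmul_eq_mul, h3]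

theorem polyRoot_le_mul (m n : ℕ+) : polyRoot E m ≤ polyRoot E (m * n) := by
  rintro _ ⟨p, rfl⟩
  refine ⟨p.comp (Polynomial.X ^ (n : ℕ)), ?_⟩
  simp only [Polynomial.coe_eval₂RingHom, Polynomial.eval₂_comp, Polynomial.eval₂_pow,
    Polynomial.eval₂_X, tRoot_mul_pow]

/-- The ring `⋃ₙ E[t ^ (1/n)]` of Puiseux polynomials. -/
def PuiseuxPoly : Subring (PuiseuxField E) where
  carrier := {x | ∃ n : ℕ+, x ∈ polyRoot E n}
  mul_mem' := by
    rintro a b ⟨m, hm⟩ ⟨n, hn⟩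
    exact ⟨m * n, mul_mem (polyRoot_le_mul E m n hm)
      (mul_comm m n ▸ polyRoot_le_mul E n m hn)⟩
  add_mem' := by
    rintro a b ⟨m, hm⟩ ⟨n, hn⟩
    exact ⟨m * n, add_mem (polyRoot_le_mul E m n hm)
      (mul_comm m n ▸ polyRoot_le_mul E n m hn)⟩
  zero_mem' := ⟨1, zero_mem _⟩
  one_mem' := ⟨1, one_mem _⟩
  neg_mem' := by
    rintro a ⟨n, hn⟩
    exact ⟨n, neg_mem hn⟩

/-- The valuation `ν` on the Puiseux field: the least exponent of `t⁻¹` that occurs. -/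
def puiseuxVal : AddValuation (PuiseuxField E) (WithTop ℚ) :=
  (HahnSeries.addVal ℚ E).comap (PuiseuxField E).subtype

/-- The topology and uniform structure on the Puiseux field that `ν` defines. -/
instance : Valued (PuiseuxField E) (Multiplicative (WithTop ℚ)ᵒᵈ) :=
  Valued.mk' (AddValuation.toValuation (puiseuxVal E))

/-- The completion of the Puiseux field. -/
abbrev Khat : Type _ := UniformSpace.Completion (PuiseuxField E)

/-- The valuation `ν` on the completion, with values in `ℚ ∪ {∞}` seen in `ℝ ∪ {∞}`. -/
def valHat : AddValuation (Khat E) (WithTop ℝ) :=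
  (AddValuation.ofValuation
    (Valued.v : Valuation (Khat E) (Multiplicative (WithTop ℚ)ᵒᵈ))).map
    (AddMonoidHom.withTopMap (Rat.castHom ℝ : ℚ →+ ℝ)) rfl
    (by
      change Monotone (WithTop.map (fun q : ℚ => (q : ℝ)))
      exact WithTop.monotone_map_iff.2 Rat.cast_mono)

/-- The inclusion of the Puiseux polynomials in the completed Puiseux field. -/
def polyToKhat : PuiseuxPoly E →+* Khat E :=
  UniformSpace.Completion.coeRingHom.comp (PuiseuxPoly E).subtype

end Field

/-! ### Points of type II and III of the Berkovich line, and the action of `GL₂` -/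

section Berkovich

variable {L : Type*} [Field L] (ν : AddValuation L (WithTop ℝ))

/-- The real number `ν x`, for `x ≠ 0`. -/
def realVal (x : L) : ℝ := (ν x).untopD 0

theorem coe_realVal {x : L} (hx : x ≠ 0) : ((realVal ν x : ℝ) : WithTop ℝ) = ν x := by
  have h : ν x ≠ ⊤ := fun h => hx ((AddValuation.top_iff ν).1 h)
  obtain ⟨a, ha⟩ := WithTop.ne_top_iff_exists.1 h
  simp [realVal, ← ha]

theorem min_val_congr {w w' f : L} {c : WithTop ℝ} (hw : w = w' + f) (hf : c ≤ ν f) :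
    min c (ν w) = min c (ν w') := by
  apply le_antisymm
  · refine le_min (min_le_left _ _) ?_
    have : w' = w - f := by rw [hw]; ring
    rw [this]
    exact ν.map_le_sub (min_le_right _ _) ((min_le_left _ _).trans hf)
  · refine le_min (min_le_left _ _) ?_
    rw [hw]
    exact ν.map_le_add (min_le_right _ _) ((min_le_left _ _).trans hf)

theorem min_val_add_congr {w s e f : L} {c : WithTop ℝ} (hs : s = e + f) (hf : ν w ≤ ν f + c) :
    min (ν s + c) (ν w) = min (ν e + c) (ν w) := by
  apply le_antisymm
  · refine le_min ?_ (min_le_right _ _)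
    have : e = s - f := by rw [hs]; ring
    calc min (ν s + c) (ν w) ≤ min (ν s + c) (ν f + c) := min_le_min le_rfl hf
      _ = min (ν s) (ν f) + c := min_add_add_right _ _ _
      _ ≤ ν e + c := by rw [this]; gcongr; exact ν.map_sub _ _
  · refine le_min ?_ (min_le_right _ _)
    calc min (ν e + c) (ν w) ≤ min (ν e + c) (ν f + c) := min_le_min le_rfl hf
      _ = min (ν e) (ν f) + c := min_add_add_right _ _ _
      _ ≤ ν s + c := by rw [hs]; gcongr; exact ν.map_add _ _

theorem val_div {x y : L} (hx : x ≠ 0) (hy : y ≠ 0) :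
    ν (x / y) = ((realVal ν x - realVal ν y : ℝ) : WithTop ℝ) := by
  have h : ν (x / y) + ν y = ν x := by rw [← ν.map_mul, div_mul_cancel₀ _ hy]
  rw [← coe_realVal ν (div_ne_zero hx hy)] at h ⊢
  rw [← coe_realVal ν hx, ← coe_realVal ν hy, ← WithTop.coe_add, WithTop.coe_inj] at h
  rw [← h]
  congr 1
  ring

/-- `(a, r) ∼ (a', r')` when the closed balls `{b | r ≤ ν (b - a)}` and `{b | r' ≤ ν (b - a')}` have
the same radius `r = r'` and `r ≤ ν (a - a')`. -/
def ballSetoid : Setoid (L × ℝ) where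
  r x y := x.2 = y.2 ∧ (x.2 : WithTop ℝ) ≤ ν (x.1 - y.1)
  iseqv :=
    { refl := fun x => by simp
      symm := by
        rintro x y ⟨h1, h2⟩
        exact ⟨h1.symm, by rwa [← h1, ν.map_sub_swap]⟩
      trans := by
        rintro x y z ⟨h1, h2⟩ ⟨h3, h4⟩
        refine ⟨h1.trans h3, ?_⟩
        have : x.1 - z.1 = (x.1 - y.1) + (y.1 - z.1) := by ring
        rw [this]
        exact ν.map_le_add h2 (h1 ▸ h4) }

/-- The set of points of type II and III of the Berkovich projective line over `L`. -/
def BerkH : Type _ := Quotient (ballSetoid ν)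

variable {ν} in
/-- The point `η_{a,r}`. -/
def eta (a : L) (r : ℝ) : BerkH ν := Quotient.mk (ballSetoid ν) (a, r)

/-- The quotient topology of the product topology on `L × ℝ`. -/
@[reducible]
def quotientTopology [TopologicalSpace L] : TopologicalSpace (BerkH ν) :=
  inferInstanceAs (TopologicalSpace (Quotient (ballSetoid ν)))

/-! The valuation (in the sense of `η` as a multiplicative seminorm) of a linear polynomial
`p * T + q`; it is used to verify that the action below is well defined. -/

/-- The minimum of `ν (p * b + q)` over the ball of `(a, r)`. -/
def linRep (x : L × ℝ) (p q : L) : WithTop ℝ := min (ν p + (x.2 : WithTop ℝ)) (ν (p * x.1 + q))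

theorem linRep_congr {x y : L × ℝ} (h : (ballSetoid ν).r x y) (p q : L) :
    linRep ν x p q = linRep ν y p q := by
  obtain ⟨h1, h2⟩ := h
  unfold linRep
  rw [← h1]
  refine min_val_congr ν (f := p * (x.1 - y.1)) (by ring) ?_
  rw [ν.map_mul]
  gcongr

theorem rel_of_linRep {x y : L × ℝ} (h : ∀ p q, linRep ν x p q = linRep ν y p q) :
    (ballSetoid ν).r x y := by
  have h1 := h 1 (-x.1)
  have h2 := h 1 (-y.1)
  simp only [linRep, ν.map_one, zero_add, one_mul, ← sub_eq_add_neg, sub_self, ν.map_zero,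
    min_eq_left le_top] at h1 h2
  have h3 : (x.2 : WithTop ℝ) ≤ y.2 := h1.le.trans (min_le_left _ _)
  have h4 : (y.2 : WithTop ℝ) ≤ x.2 := h2.ge.trans (min_le_left _ _)
  refine ⟨le_antisymm (WithTop.coe_le_coe.1 h3) (WithTop.coe_le_coe.1 h4), ?_⟩
  rw [ν.map_sub_swap]
  exact h1.le.trans (min_le_right _ _)

/-- The image of a closed ball under `z ↦ (α z + β) / (γ z + δ)`, as a pair of a centre and a
radius. If the pole does not lie in the ball, then the image of the centre is a centre of the image.
Otherwise the point `η` goes to the ball around the image `α / γ` of `∞`. -/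
def moebiusRep (g : GL (Fin 2) L) (x : L × ℝ) : L × ℝ :=
  open Classical in
  if ν (g 1 0) + (x.2 : WithTop ℝ) ≤ ν (g 1 0 * x.1 + g 1 1) then
    (g 0 0 / g 1 0, realVal ν (g : Matrix (Fin 2) (Fin 2) L).det - 2 * realVal ν (g 1 0) - x.2)
  else
    ((g 0 0 * x.1 + g 0 1) / (g 1 0 * x.1 + g 1 1),
      x.2 + realVal ν (g : Matrix (Fin 2) (Fin 2) L).det
        - 2 * realVal ν (g 1 0 * x.1 + g 1 1))

theorem det_ne_zero (g : GL (Fin 2) L) : (g : Matrix (Fin 2) (Fin 2) L).det ≠ 0 :=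
  (Matrix.GeneralLinearGroup.det g).ne_zero

theorem linRep_ne_top (g : GL (Fin 2) L) (x : L × ℝ) : linRep ν x (g 1 0) (g 1 1) ≠ ⊤ := by
  intro h
  rw [linRep, min_eq_top, WithTop.add_eq_top] at h
  obtain ⟨h1 | h1, h2⟩ := h
  · have h1' := (AddValuation.top_iff ν).1 h1
    have h2' := (AddValuation.top_iff ν).1 h2
    rw [h1', zero_mul, zero_add] at h2'
    apply det_ne_zero g
    rw [Matrix.det_fin_two, h1', h2']
    ring
  · exact WithTop.coe_ne_top h1

theorem linRep_moebiusRep (g : GL (Fin 2) L) (x : L × ℝ) (p q : L) :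
    linRep ν (moebiusRep ν g x) p q + linRep ν x (g 1 0) (g 1 1) =
      linRep ν x (p * g 0 0 + q * g 1 0) (p * g 0 1 + q * g 1 1) := by
  have hD := det_ne_zero g
  have hDe : (g : Matrix (Fin 2) (Fin 2) L).det = g 0 0 * g 1 1 - g 0 1 * g 1 0 :=
    Matrix.det_fin_two _
  have hDv := coe_realVal ν hD
  unfold moebiusRep
  split_ifs with hc
  · have hγ : g 1 0 ≠ 0 := by
      intro h0
      rw [h0, ν.map_zero, WithTop.top_add, top_le_iff, AddValuation.top_iff, zero_mul,
        zero_add] at hc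
      apply hD
      rw [hDe, h0, hc]
      ring
    have hγv := coe_realVal ν hγ
    have e1 : linRep ν x (g 1 0) (g 1 1) = ν (g 1 0) + (x.2 : WithTop ℝ) := min_eq_left hc
    have c1 : ν p + ((realVal ν (g : Matrix (Fin 2) (Fin 2) L).det - 2 * realVal ν (g 1 0) - x.2 :
        ℝ) : WithTop ℝ) + (ν (g 1 0) + (x.2 : WithTop ℝ)) =
        ν (p * ((g : Matrix (Fin 2) (Fin 2) L).det / g 1 0)) := by
      rw [ν.map_mul, val_div ν hD hγ, ← hγv, ← WithTop.coe_add, add_assoc, ← WithTop.coe_add]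
      congr 2
      ring
    have c2 : ν (p * (g 0 0 / g 1 0) + q) + (ν (g 1 0) + (x.2 : WithTop ℝ)) =
        ν (p * g 0 0 + q * g 1 0) + (x.2 : WithTop ℝ) := by
      rw [← add_assoc, ← ν.map_mul]
      congr 2
      field_simp
    rw [e1, linRep, linRep, ← min_add_add_right]
    dsimp only
    rw [c1, c2, min_comm]
    symm
    rw [← ν.map_neg (p * _)]
    refine min_val_congr ν
      (f := (p * g 0 0 + q * g 1 0) * ((g 1 0 * x.1 + g 1 1) / g 1 0)) ?_ ?_
    · rw [hDe]
      field_simp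
      ring
    · rw [ν.map_mul]
      gcongr
      by_cases hu : g 1 0 * x.1 + g 1 1 = 0
      · simp [hu]
      · rw [val_div ν hu hγ, WithTop.coe_le_coe]
        rw [← hγv, ← coe_realVal ν hu, ← WithTop.coe_add, WithTop.coe_le_coe] at hc
        linarith
  · rw [not_le] at hc
    have hu : g 1 0 * x.1 + g 1 1 ≠ 0 := by
      intro h0
      rw [h0, ν.map_zero] at hc
      exact not_top_lt hc
    have huv := coe_realVal ν hu
    have e1 : linRep ν x (g 1 0) (g 1 1) = ν (g 1 0 * x.1 + g 1 1) := min_eq_right hc.le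
    have c1 : ν p + ((x.2 + realVal ν (g : Matrix (Fin 2) (Fin 2) L).det
        - 2 * realVal ν (g 1 0 * x.1 + g 1 1) : ℝ) : WithTop ℝ) + ν (g 1 0 * x.1 + g 1 1) =
        ν (p * ((g : Matrix (Fin 2) (Fin 2) L).det / (g 1 0 * x.1 + g 1 1))) +
          (x.2 : WithTop ℝ) := by
      rw [ν.map_mul, val_div ν hD hu, ← huv, add_assoc, add_assoc, ← WithTop.coe_add,
        ← WithTop.coe_add]
      congr 2
      ring
    have c2 : ν (p * ((g 0 0 * x.1 + g 0 1) / (g 1 0 * x.1 + g 1 1)) + q) +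
        ν (g 1 0 * x.1 + g 1 1) =
        ν ((p * g 0 0 + q * g 1 0) * x.1 + (p * g 0 1 + q * g 1 1)) := by
      rw [← ν.map_mul, add_mul, mul_assoc p, div_mul_cancel₀ _ hu]
      congr 1
      ring
    rw [e1, linRep, linRep, ← min_add_add_right]
    dsimp only
    rw [c1, c2]
    symm
    refine min_val_add_congr ν
      (f := ((p * g 0 0 + q * g 1 0) * x.1 + (p * g 0 1 + q * g 1 1)) *
        (g 1 0 / (g 1 0 * x.1 + g 1 1))) ?_ ?_
    · rw [hDe]
      field_simp
      ring
    · rw [ν.map_mul, add_assoc]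
      refine le_add_of_nonneg_right ?_
      by_cases hγ : g 1 0 = 0
      · simp [hγ]
      · rw [val_div ν hγ hu, ← WithTop.coe_add, ← WithTop.coe_zero, WithTop.coe_le_coe]
        rw [← huv, ← coe_realVal ν hγ, ← WithTop.coe_add, WithTop.coe_lt_coe] at hc
        linarith

theorem moebiusRep_congr (g : GL (Fin 2) L) {x y : L × ℝ} (h : (ballSetoid ν).r x y) :
    (ballSetoid ν).r (moebiusRep ν g x) (moebiusRep ν g y) := by
  refine rel_of_linRep ν fun p q => ?_
  have h1 := linRep_moebiusRep ν g x p q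
  rw [linRep_congr ν h, linRep_congr ν h, ← linRep_moebiusRep ν g y p q] at h1
  exact (WithTop.add_right_inj (linRep_ne_top ν g y)).1 h1

/-- The action of `GL₂` by Möbius transformations on the points of type II and III. -/
instance : MulAction (GL (Fin 2) L) (BerkH ν) where
  smul g := Quotient.map (moebiusRep ν g) fun _ _ h => moebiusRep_congr ν g h
  one_smul := by
    rintro ⟨x⟩
    refine Quotient.sound (rel_of_linRep ν fun p q => ?_)
    have h := linRep_moebiusRep ν 1 x p q
    have h1 : linRep ν x ((1 : GL (Fin 2) L) 1 0) ((1 : GL (Fin 2) L) 1 1) = 0 := by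
      simp [linRep]
    rw [h1, add_zero] at h
    simpa using h
  mul_smul := by
    rintro g h ⟨x⟩
    refine Quotient.sound (rel_of_linRep ν fun p q => ?_)
    have e1 := linRep_moebiusRep ν (g * h) x p q
    have e2 := linRep_moebiusRep ν g (moebiusRep ν h x) p q
    have e3 := linRep_moebiusRep ν h x (p * g 0 0 + q * g 1 0) (p * g 0 1 + q * g 1 1)
    have e4 := linRep_moebiusRep ν h x (g 1 0) (g 1 1)
    have m : ∀ i j, (g * h) i j = g i 0 * h 0 j + g i 1 * h 1 j := by
      intro i j
      simp [Matrix.mul_apply, Fin.sum_univ_two]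
    rw [← m, ← m] at e4
    refine (WithTop.add_right_inj (linRep_ne_top ν (g * h) x)).1 ?_
    rw [e1, ← e4, ← add_assoc, e2, e3]
    congr 1 <;> rw [m, m] <;> ring

/-! The metric. -/

/-- The distance between the points `η_{a,r}` and `η_{a',r'}`. -/
def distRep (x y : L × ℝ) : ℝ :=
  open Classical in
  if ((min x.2 y.2 : ℝ) : WithTop ℝ) ≤ ν (x.1 - y.1) then |x.2 - y.2|
  else x.2 + y.2 - 2 * realVal ν (x.1 - y.1)

/-- The radius `min (r, r', ν (a - a'))` of the join of `η_{a,r}` and `η_{a',r'}`. -/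
def joinRep (x y : L × ℝ) : WithTop ℝ := min ((min x.2 y.2 : ℝ) : WithTop ℝ) (ν (x.1 - y.1))

theorem joinRep_eq (x y : L × ℝ) :
    joinRep ν x y = (((x.2 + y.2 - distRep ν x y) / 2 : ℝ) : WithTop ℝ) := by
  unfold joinRep distRep
  split_ifs with h
  · rw [min_eq_left h]
    congr 1
    rcases le_total x.2 y.2 with h' | h'
    · rw [min_eq_left h', abs_of_nonpos (by linarith)]
      ring
    · rw [min_eq_right h', abs_of_nonneg (by linarith)]
      ring
  · rw [not_le] at h
    have h0 : x.1 - y.1 ≠ 0 := by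
      intro h0
      rw [h0, ν.map_zero] at h
      exact not_top_lt h
    rw [min_eq_right h.le, ← coe_realVal ν h0]
    congr 1
    ring

theorem joinRep_comm (x y : L × ℝ) : joinRep ν x y = joinRep ν y x := by
  rw [joinRep, joinRep, min_comm x.2, ν.map_sub_swap]

theorem min_joinRep_le (x y z : L × ℝ) :
    min (joinRep ν x y) (joinRep ν y z) ≤ joinRep ν x z := by
  refine le_min ?_ ?_
  · rw [WithTop.coe_min]
    refine le_min ?_ ?_
    · exact (min_le_left _ _).trans ((min_le_left _ _).trans
        (WithTop.coe_le_coe.2 (min_le_left _ _)))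
    · exact (min_le_right _ _).trans ((min_le_left _ _).trans
        (WithTop.coe_le_coe.2 (min_le_right _ _)))
  · have : x.1 - z.1 = (x.1 - y.1) + (y.1 - z.1) := by ring
    rw [this]
    exact ν.map_le_add ((min_le_left _ _).trans (min_le_right _ _))
      ((min_le_right _ _).trans (min_le_right _ _))

theorem distRep_comm (x y : L × ℝ) : distRep ν x y = distRep ν y x := by
  have h := joinRep_comm ν x y
  rw [joinRep_eq, joinRep_eq, WithTop.coe_inj] at h
  linarith

theorem distRep_triangle (x y z : L × ℝ) :
    distRep ν x z ≤ distRep ν x y + distRep ν y z := by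
  have h := min_joinRep_le ν x y z
  have h1 : joinRep ν x y ≤ (y.2 : WithTop ℝ) :=
    (min_le_left _ _).trans (WithTop.coe_le_coe.2 (min_le_right _ _))
  have h2 : joinRep ν y z ≤ (y.2 : WithTop ℝ) :=
    (min_le_left _ _).trans (WithTop.coe_le_coe.2 (min_le_left _ _))
  rw [joinRep_eq, WithTop.coe_le_coe] at h1 h2
  rw [joinRep_eq, joinRep_eq, joinRep_eq, ← WithTop.coe_min, WithTop.coe_le_coe, min_le_iff] at h
  rcases h with h | h <;> linarith

theorem distRep_eq_zero_iff (x y : L × ℝ) : distRep ν x y = 0 ↔ (ballSetoid ν).r x y := by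
  constructor
  · intro h
    have h1 := joinRep_eq ν x y
    rw [h, sub_zero] at h1
    have h2 : joinRep ν x y ≤ ((min x.2 y.2 : ℝ) : WithTop ℝ) := min_le_left _ _
    have h3 : joinRep ν x y ≤ ν (x.1 - y.1) := min_le_right _ _
    rw [h1, WithTop.coe_le_coe] at h2
    have h4 := min_le_left x.2 y.2
    have h5 := min_le_right x.2 y.2
    have h6 : x.2 = y.2 := by linarith
    refine ⟨h6, ?_⟩
    rw [h1, ← h6] at h3
    simpa using h3
  · rintro ⟨h1, h2⟩
    rw [distRep, if_pos, h1, sub_self, abs_zero]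
    rwa [← h1, min_self]

theorem distRep_congr (x y x' y' : L × ℝ) (hx : (ballSetoid ν).r x x')
    (hy : (ballSetoid ν).r y y') : distRep ν x y = distRep ν x' y' := by
  rw [← distRep_eq_zero_iff] at hx hy
  have h1 := distRep_triangle ν x x' y
  have h2 := distRep_triangle ν x' y' y
  have h3 := distRep_triangle ν x' x y'
  have h4 := distRep_triangle ν x y y'
  rw [distRep_comm ν y' y] at h2
  rw [distRep_comm ν x' x] at h3
  linarith

/-- The metric on the set of points of type II and III. -/
@[reducible]
def berkMetric : MetricSpace (BerkH ν) where
  dist := Quotient.lift₂ (distRep ν) (distRep_congr ν)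
  dist_self := by
    rintro ⟨x⟩
    exact (distRep_eq_zero_iff ν x x).2 ((ballSetoid ν).refl x)
  dist_comm := by
    rintro ⟨x⟩ ⟨y⟩
    exact distRep_comm ν x y
  dist_triangle := by
    rintro ⟨x⟩ ⟨y⟩ ⟨z⟩
    exact distRep_triangle ν x y z
  eq_of_dist_eq_zero := by
    rintro ⟨x⟩ ⟨y⟩ h
    exact Quotient.sound ((distRep_eq_zero_iff ν x y).1 h)

/-- The topology of the metric. -/
@[reducible]
def metricTopology : TopologicalSpace (BerkH ν) :=
  (berkMetric ν).toUniformSpace.toTopologicalSpace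

end Berkovich

/-! ### The modular ray and the orbit space -/

section Ray

variable (E : Type*) [Field E]

/-- The set of points of type II and III of the Berkovich projective line over the completed
Puiseux field. -/
abbrev HBerk : Type _ := BerkH (valHat E)

/-- The action of `SL₂` of the ring of Puiseux polynomials, as a subgroup of `GL₂` of the completed
Puiseux field. -/
instance : MulAction SL(2, PuiseuxPoly E) (HBerk E) :=
  MulAction.compHom (HBerk E) ((Matrix.SpecialLinearGroup.toGL (n := Fin 2) (R := Khat E)).comp
    (Matrix.SpecialLinearGroup.map (polyToKhat E)))

/-- The orbit space of `SL₂` of the ring of Puiseux polynomials; its topology is the quotient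
topology of any given topology on `HBerk E`. -/
abbrev OrbitSpace : Type _ := MulAction.orbitRel.Quotient SL(2, PuiseuxPoly E) (HBerk E)

/-- The canonical projection to the orbit space. -/
def orbitProj (η : HBerk E) : OrbitSpace E := Quotient.mk _ η

/-- The modular ray `{η_{0,r} | r ≤ 0}`. -/
def modularRay : Set (HBerk E) := {η | ∃ r : ℝ, r ≤ 0 ∧ η = eta 0 r}

end Ray

end PuiseuxRay

end

/-!
The inverse of the projection of the modular ray is given by an invariant of the orbits, their
height, that is defined by reduction theory of binary forms.

A point `η_{a,r}` gives the linear form `p * T + q` the valuation `min (ν p + r, ν (p * a + q))`.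
After subtraction of `r / 2`, this function on pairs `(p, q)` is equivariant under matrices of
determinant `1` (`normalizedValSet_moebiusRep_subset`), so that its supremum over the nonzero pairs
of Puiseux polynomials is an invariant of the orbit. For fixed `(p, q)` it is `1 / 2`-Lipschitz in
the point (`sub_half_distRep_mem_normalizedValSet`), and hence so is the supremum. At a point
`η_{0,r}` of the modular ray the supremum is `- r / 2` (`normalizedValSet_zero`), because nonzero
Puiseux polynomials have valuation at most `0`. Therefore the modular ray meets every orbit at most
once. It meets every orbit by the continued fraction algorithm
(`exists_orbitProj_eq_of_laurentRoot`): replace the centre by a Puiseux series in the same ball,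
with exponents in `(1 / n) ℤ`, subtract its polynomial part, apply `z ↦ -1 / z`, and repeat. The
denominator `n` does not change, and each step that does not reach the ray lowers the radius `r` by
at least `2 / n`.

So the height, the parameter `r ≤ 0` at which an orbit meets the ray, is a `1`-Lipschitz function of
the point for the metric. The quotient topology is finer than the metric topology
(`quotientTopology_le_metricTopology`), so the height is continuous for both, and `r ↦ η_{0,r}` is
continuous for both as well. Their composite is the continuous inverse.
-/

noncomputable section

namespace PuiseuxRay

/-! ### The valuation on the completed Puiseux field -/

section Valuation

variable {E : Type*} [Field E]

theorem valHat_coe (x : PuiseuxField E) :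
    valHat E (x : Khat E) = (x : E⟦ℚ⟧).orderTop.map (fun q : ℚ => (q : ℝ)) := by
  change WithTop.map _ (OrderDual.ofDual (Multiplicative.toAdd
    (Valued.v (x : Khat E) : Multiplicative (WithTop ℚ)ᵒᵈ))) = _
  rw [Valued.valuedCompletion_apply]
  rfl

theorem valHat_le_iff (x y : Khat E) :
    valHat E x ≤ valHat E y ↔
      (Valued.v y : Multiplicative (WithTop ℚ)ᵒᵈ) ≤ Valued.v x := by
  change WithTop.map (fun q : ℚ => (q : ℝ)) _ ≤ WithTop.map _ _ ↔ _
  exact WithTop.map_le_iff _ (fun {a b} => Rat.cast_le)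

theorem exists_valHat_eq_natCast (N : ℕ) : ∃ c : Khat E, valHat E c = ((N : ℝ) : WithTop ℝ) := by
  refine ⟨((tRoot E 1)⁻¹ ^ N : PuiseuxField E), ?_⟩
  have h : (((tRoot E 1)⁻¹ ^ N : PuiseuxField E) : E⟦ℚ⟧) = HahnSeries.single (N : ℚ) 1 := by
    have h1 : (((tRoot E 1)⁻¹ : PuiseuxField E) : E⟦ℚ⟧) = HahnSeries.single (1 : ℚ) 1 := by
      change (HahnSeries.single (-1 / (((1 : ℕ+) : ℕ) : ℚ)) (1 : E))⁻¹ = _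
      rw [HahnSeries.inv_single]
      simp
    rw [SubmonoidClass.coe_pow, h1, HahnSeries.single_pow]
    simp
  rw [valHat_coe, h, HahnSeries.orderTop_single one_ne_zero]
  simp

/-- Closed balls are neighbourhoods of their centres. An element `c` of large valuation serves as
the radius, because `Valued.isOpen_closedBall` wants a radius in the value group. -/
theorem setOf_le_valHat_sub_mem_nhds (a : Khat E) (r : ℝ) :
    {b : Khat E | (r : WithTop ℝ) ≤ valHat E (b - a)} ∈ 𝓝 a := by
  obtain ⟨n, hn⟩ := exists_nat_gt r
  obtain ⟨c, hc⟩ := exists_valHat_eq_natCast (E := E) n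
  have hc0 : c ≠ 0 := by
    rintro rfl
    rw [AddValuation.map_zero] at hc
    exact WithTop.top_ne_coe hc
  have hopen : IsOpen {x : Khat E | valHat E c ≤ valHat E x} := by
    have hset : {x : Khat E | valHat E c ≤ valHat E x} =
        {x | (Valued.v : Valuation (Khat E) (Multiplicative (WithTop ℚ)ᵒᵈ)).restrict x ≤
          Valued.v.restrict c} :=
      Set.ext fun x => (valHat_le_iff c x).trans (Valuation.restrict_le_iff _).symm
    rw [hset]
    exact Valued.isOpen_closedBall _ ((Valuation.ne_zero_iff _).2 hc0)
  have hcont : Continuous fun b : Khat E => b - a := by fun_prop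
  refine Filter.mem_of_superset ((hopen.preimage hcont).mem_nhds ?_) fun b hb => ?_
  · simp
  · change (r : WithTop ℝ) ≤ valHat E (b - a)
    exact (WithTop.coe_le_coe.2 hn.le).trans (hc ▸ hb)

theorem exists_puiseux_close (a : Khat E) (r : ℝ) :
    ∃ b : PuiseuxField E, (r : WithTop ℝ) ≤ valHat E (a - b) := by
  obtain ⟨b, hb⟩ := UniformSpace.Completion.denseRange_coe.exists_mem_open isOpen_interior
    ⟨a, mem_interior_iff_mem_nhds.2 (setOf_le_valHat_sub_mem_nhds a r)⟩
  refine ⟨b, ?_⟩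
  rw [AddValuation.map_sub_swap]
  have hb' := interior_subset hb
  exact hb'

/-- The monomials of nonnegative degree in `t ^ (1/n)`, found in `E((t ^ (-1/n)))`. -/
theorem single_mem_polyRoot (n : ℕ+) (k : ℕ) (c : E) :
    ∃ f ∈ polyRoot E n, (f : E⟦ℚ⟧) = substRoot E n (HahnSeries.single (-k : ℤ) c) := by
  refine ⟨_, ⟨Polynomial.monomial k c, rfl⟩, ?_⟩
  rw [substRoot, HahnSeries.embDomainRingHom_apply, HahnSeries.embDomain_single,
    Polynomial.coe_eval₂RingHom, Polynomial.eval₂_monomial]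
  change HahnSeries.single 0 c * (HahnSeries.single (-1 / ((n : ℕ) : ℚ)) (1 : E)) ^ k = _
  rw [HahnSeries.single_pow, HahnSeries.single_mul_single]
  simp [divHom]
  rw [show (k : ℚ) * (-1 / (n : ℕ)) = -k / (n : ℕ) by ring]

theorem polyRoot_coeff_eq_zero {n : ℕ+} {f : PuiseuxField E} (hf : f ∈ polyRoot E n) {q : ℚ}
    (hq : 0 < q) : (f : E⟦ℚ⟧).coeff q = 0 := by
  obtain ⟨p, rfl⟩ := hf
  induction p using Polynomial.induction_on' with
  | add p₁ p₂ h₁ h₂ => simp_all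
  | monomial k c =>
    rw [Polynomial.coe_eval₂RingHom, Polynomial.eval₂_monomial]
    change (HahnSeries.single 0 c * (HahnSeries.single (-1 / ((n : ℕ) : ℚ)) (1 : E)) ^ k).coeff q
      = 0
    rw [HahnSeries.single_pow, HahnSeries.single_mul_single]
    apply HahnSeries.coeff_single_of_ne
    have : (0 : ℚ) ≤ k * (1 / (n : ℕ)) := by positivity
    rw [nsmul_eq_mul, neg_div, mul_neg]
    intro h
    linarith

theorem valHat_polyToKhat_nonpos {f : PuiseuxPoly E} (hf : f ≠ 0) :
    valHat E (polyToKhat E f) ≤ 0 := by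
  obtain ⟨n, hn⟩ := f.2
  have h0 : ((f : PuiseuxField E) : E⟦ℚ⟧) ≠ 0 := by simpa using hf
  change valHat E ((f : PuiseuxField E) : Khat E) ≤ 0
  rw [valHat_coe, ← HahnSeries.order_eq_orderTop_of_ne_zero h0, WithTop.map_coe,
    ← WithTop.coe_zero, WithTop.coe_le_coe, Rat.cast_nonpos]
  by_contra! h
  exact HahnSeries.coeff_order_eq_zero.not.2 h0 (polyRoot_coeff_eq_zero hn h)

/-- Division with remainder: removing the polynomial part of a series in `t ^ (-1/n)` leaves a
remainder of valuation at least `1 / n`. -/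
theorem exists_poly_sub_val_ge {n : ℕ+} {b : PuiseuxField E} (hb : (b : E⟦ℚ⟧) ∈ laurentRoot E n) :
    ∃ f : PuiseuxPoly E, ((b - f : PuiseuxField E) : E⟦ℚ⟧) ∈ laurentRoot E n ∧
      ((1 / (n : ℕ) : ℝ) : WithTop ℝ) ≤ valHat E ((b - f : PuiseuxField E) : Khat E) := by
  obtain ⟨x, hx⟩ := hb
  choose f hf hf' using fun k : ℕ => single_mem_polyRoot n k (x.coeff (-k : ℤ))
  -- `P` collects the terms of `x` of exponent at most `0` in `t ^ (-1/n)`; there are none with an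
  -- exponent below `-N`.
  let N := x.order.natAbs + 1
  let P : LaurentSeries E := ∑ k ∈ Finset.range N, HahnSeries.single (-k : ℤ) (x.coeff (-k : ℤ))
  have hP : ((∑ k ∈ Finset.range N, f k : PuiseuxField E) : E⟦ℚ⟧) = substRoot E n P := by
    simp only [P, map_sum, ← hf']
    exact map_sum (PuiseuxField E).subtype _ _
  have hsub : ((b - ∑ k ∈ Finset.range N, f k : PuiseuxField E) : E⟦ℚ⟧) =
      substRoot E n (x - P) := by
    rw [map_sub, ← hP, hx]; rfl
  have hcoeff : ∀ m : ℤ, m ≤ 0 → (x - P).coeff m = 0 := by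
    intro m hm
    obtain ⟨k, rfl⟩ : ∃ k : ℕ, m = -k := ⟨m.natAbs, by omega⟩
    rw [HahnSeries.coeff_sub, sub_eq_zero]
    simp only [P, HahnSeries.coeff_sum]
    by_cases hk : k < N
    · rw [Finset.sum_eq_single_of_mem k (Finset.mem_range.2 hk) fun j _ hj =>
        HahnSeries.coeff_single_of_ne (by omega), HahnSeries.coeff_single_same]
    · rw [Finset.sum_eq_zero fun j hj => HahnSeries.coeff_single_of_ne (by
        have := Finset.mem_range.1 hj
        omega)]
      exact HahnSeries.coeff_eq_zero_of_lt_order (by omega)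
  refine ⟨⟨∑ k ∈ Finset.range N, f k, n, sum_mem fun k _ => hf k⟩, ?_, ?_⟩
  · exact hsub ▸ ⟨x - P, rfl⟩
  · change _ ≤ valHat E ((b - ∑ k ∈ Finset.range N, f k : PuiseuxField E) : Khat E)
    rw [valHat_coe, hsub, substRoot, HahnSeries.embDomainRingHom_apply,
      HahnSeries.orderTop_embDomain]
    have h1 : ((1 : ℤ) : WithTop ℤ) ≤ (x - P).orderTop :=
      HahnSeries.le_orderTop_iff_forall.2 fun j hj => hcoeff j
        (by have := WithTop.coe_lt_coe.1 hj; omega)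
    cases h : (x - P).orderTop with
    | top => simp
    | coe m =>
      rw [h, WithTop.coe_le_coe] at h1
      simp only [WithTop.map_coe, WithTop.coe_le_coe]
      have h2 : (1 : ℝ) ≤ m := by exact_mod_cast h1
      simp only [Function.Embedding.coeFn_mk, divHom,
        RelEmbedding.coe_mk, AddMonoidHom.coe_mk, ZeroHom.coe_mk]
      push_cast
      gcongr

end Valuation

/-! ### The two topologies -/

section Topologies

variable {L : Type*} [Field L] (ν : AddValuation L (WithTop ℝ))

theorem eta_eq_eta {a b : L} {r : ℝ} (h : (r : WithTop ℝ) ≤ ν (a - b)) :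
    (eta a r : BerkH ν) = eta b r :=
  Quotient.sound (s := ballSetoid ν) ⟨rfl, h⟩

/-- The quotient topology is finer than the metric topology: if `a` is close to `a'`, then
`η_{a,r}` and `η_{a',r'}` are at distance `|r - r'|`. -/
theorem quotientTopology_le_metricTopology [TopologicalSpace L]
    (hν : ∀ (a : L) (r : ℝ), {b | (r : WithTop ℝ) ≤ ν (b - a)} ∈ 𝓝 a) :
    quotientTopology ν ≤ metricTopology ν := by
  refine continuous_iff_coinduced_le.1 ?_
  let _ := berkMetric ν
  refine continuous_iff_continuousAt.2 fun x => Metric.tendsto_nhds.2 fun ε hε => ?_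
  rw [nhds_prod_eq]
  filter_upwards [Filter.prod_mem_prod (hν x.1 x.2) (Metric.ball_mem_nhds x.2 hε)]
  rintro y ⟨hy₁, hy₂⟩
  change distRep ν y x < ε
  rw [distRep, if_pos ((WithTop.coe_le_coe.2 (min_le_right _ _)).trans hy₁)]
  exact hy₂

theorem continuous_eta_zero_quotientTopology [TopologicalSpace L] :
    @Continuous _ _ _ (quotientTopology ν) fun r : ℝ => (eta 0 r : BerkH ν) := by
  refine continuous_quotient_mk'.comp (?_ : Continuous fun r : ℝ => ((0, r) : L × ℝ))
  fun_prop

end Topologies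

/-! ### Normalized valuations of linear forms -/

section NormalizedVal

variable {L : Type*} [Field L] (ν : AddValuation L (WithTop ℝ))

/-- The real numbers that are at most `min (ν p + r, ν (p * a + q)) - r / 2` for some `(p, q) ∈ V`,
where `x = (a, r)`. As a set closed downwards, it records the supremum of these values without a
choice of what the supremum should be for an unbounded set. The subtraction of `r / 2` makes the
valuation of linear forms attached to `(a, r)` equivariant under `SL₂`. -/
def normalizedValSet (V : Set (L × L)) (x : L × ℝ) : Set ℝ :=
  {m | ∃ v ∈ V, ((m + x.2 / 2 : ℝ) : WithTop ℝ) ≤ linRep ν x v.1 v.2}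

/-- The valuation of a fixed linear form, normalized by `- r / 2`, is `1 / 2`-Lipschitz: both points
are compared with the ball of radius `joinRep ν x y` that contains both of them. -/
theorem sub_half_distRep_mem_normalizedValSet {V : Set (L × L)} {x : L × ℝ} {m : ℝ}
    (hm : m ∈ normalizedValSet ν V x) (y : L × ℝ) :
    m - distRep ν x y / 2 ∈ normalizedValSet ν V y := by
  obtain ⟨⟨p, q⟩, hv, h⟩ := hm
  refine ⟨(p, q), hv, ?_⟩
  have hj := joinRep_eq ν x y
  have hjx : joinRep ν x y ≤ (x.2 : WithTop ℝ) :=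
    (min_le_left _ _).trans (WithTop.coe_le_coe.2 (min_le_left _ _))
  have hjy : joinRep ν x y ≤ (y.2 : WithTop ℝ) :=
    (min_le_left _ _).trans (WithTop.coe_le_coe.2 (min_le_right _ _))
  have hjv : joinRep ν x y ≤ ν (x.1 - y.1) := min_le_right _ _
  rw [hj] at hjx hjy hjv
  rw [WithTop.coe_le_coe] at hjx hjy
  obtain ⟨h1, h2⟩ := le_min_iff.1 h
  dsimp only at h1 h2
  have h3 : ((m - distRep ν x y / 2 + y.2 / 2 : ℝ) : WithTop ℝ) ≤ ν (p * x.1 + q) :=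
    le_trans (WithTop.coe_le_coe.2 (by linarith)) h2
  by_cases hp : p = 0
  · subst hp
    simpa [linRep] using h3
  rw [← coe_realVal ν hp, ← WithTop.coe_add, WithTop.coe_le_coe] at h1
  refine le_min ?_ ?_
  · dsimp only
    rw [← coe_realVal ν hp, ← WithTop.coe_add, WithTop.coe_le_coe]
    linarith
  · have e : p * y.1 + q = (p * x.1 + q) - p * (x.1 - y.1) := by ring
    dsimp only
    rw [e]
    refine ν.map_le_sub h3 ?_
    rw [ν.map_mul, ← coe_realVal ν hp]
    refine le_trans ?_ (add_le_add_right hjv _)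
    rw [← WithTop.coe_add, WithTop.coe_le_coe]
    linarith

/-- For `g` of determinant `1` with bottom row `(γ, δ)`, the valuation of `γ * T + δ` at a point is
half of the amount by which `g` lowers the radius; this is what the normalization in
`normalizedValSet` compensates. -/
theorem linRep_of_det_eq_one {g : GL (Fin 2) L} (hg : (g : Matrix (Fin 2) (Fin 2) L).det = 1)
    (x : L × ℝ) :
    linRep ν x (g 1 0) (g 1 1) = (((x.2 - (moebiusRep ν g x).2) / 2 : ℝ) : WithTop ℝ) := by
  have h1 : realVal ν (1 : L) = 0 := by simp [realVal]
  have ht := linRep_ne_top ν g x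
  unfold moebiusRep
  split_ifs with hc
  · have e : linRep ν x (g 1 0) (g 1 1) = ν (g 1 0) + (x.2 : WithTop ℝ) := min_eq_left hc
    have hγ : g 1 0 ≠ 0 := by
      intro h
      rw [e, h] at ht
      simp at ht
    rw [e, ← coe_realVal ν hγ, ← WithTop.coe_add, hg, h1]
    congr 1
    ring
  · have e : linRep ν x (g 1 0) (g 1 1) = ν (g 1 0 * x.1 + g 1 1) := min_eq_right (not_le.1 hc).le
    have hu : g 1 0 * x.1 + g 1 1 ≠ 0 := by
      intro h
      rw [e, h] at ht
      simp at ht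
    rw [e, ← coe_realVal ν hu, hg, h1]
    congr 1
    ring

theorem normalizedValSet_moebiusRep_subset {V : Set (L × L)} {g : GL (Fin 2) L}
    (hg : (g : Matrix (Fin 2) (Fin 2) L).det = 1)
    (hV : ∀ v ∈ V, (v.1 * g 0 0 + v.2 * g 1 0, v.1 * g 0 1 + v.2 * g 1 1) ∈ V) (x : L × ℝ) :
    normalizedValSet ν V (moebiusRep ν g x) ⊆ normalizedValSet ν V x := by
  rintro m ⟨v, hv, h⟩
  refine ⟨_, hV v hv, ?_⟩
  rw [← linRep_moebiusRep, linRep_of_det_eq_one ν hg]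
  refine le_trans ?_ (add_le_add_left h _)
  rw [← WithTop.coe_add, WithTop.coe_le_coe]
  linarith

theorem normalizedValSet_congr {V : Set (L × L)} {x y : L × ℝ} (h : (ballSetoid ν).r x y) :
    normalizedValSet ν V x = normalizedValSet ν V y := by
  simp only [normalizedValSet, linRep_congr ν h, show x.2 = y.2 from h.1]

end NormalizedVal

/-! ### Translations and the inversion -/

section Moebius

variable {L : Type*} [Field L] (ν : AddValuation L (WithTop ℝ))

theorem moebiusRep_translation {g : GL (Fin 2) L} {f : L} (h₀₀ : g 0 0 = 1) (h₀₁ : g 0 1 = f)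
    (h₁₀ : g 1 0 = 0) (h₁₁ : g 1 1 = 1) (x : L × ℝ) : moebiusRep ν g x = (x.1 + f, x.2) := by
  simp [moebiusRep, Matrix.det_fin_two, realVal, h₀₀, h₀₁, h₁₀, h₁₁]

theorem moebiusRep_inversion_of_le {g : GL (Fin 2) L} (h₀₀ : g 0 0 = 0) (h₀₁ : g 0 1 = -1)
    (h₁₀ : g 1 0 = 1) (h₁₁ : g 1 1 = 0) {x : L × ℝ} (hx : (x.2 : WithTop ℝ) ≤ ν x.1) :
    moebiusRep ν g x = (0, -x.2) := by
  simp [moebiusRep, Matrix.det_fin_two, realVal, h₀₀, h₀₁, h₁₀, h₁₁, hx]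

theorem moebiusRep_inversion_of_not_le {g : GL (Fin 2) L} (h₀₀ : g 0 0 = 0) (h₀₁ : g 0 1 = -1)
    (h₁₀ : g 1 0 = 1) (h₁₁ : g 1 1 = 0) {x : L × ℝ} (hx : ¬ (x.2 : WithTop ℝ) ≤ ν x.1) :
    moebiusRep ν g x = (-1 / x.1, x.2 - 2 * realVal ν x.1) := by
  simp [moebiusRep, Matrix.det_fin_two, realVal, h₀₀, h₀₁, h₁₀, h₁₁, hx]

end Moebius

/-! ### Reduction to the modular ray -/

section Reduction

variable {E : Type*} [Field E]

theorem orbitProj_smul (g : SL(2, PuiseuxPoly E)) (η : HBerk E) :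
    orbitProj E (g • η) = orbitProj E η :=
  Quotient.sound (s := MulAction.orbitRel _ _) ⟨g, rfl⟩

/-- A matrix in `SL₂` of the Puiseux polynomials, seen in `GL₂` of the completed field. -/
def polyGL (g : SL(2, PuiseuxPoly E)) : GL (Fin 2) (Khat E) :=
  Matrix.SpecialLinearGroup.toGL (Matrix.SpecialLinearGroup.map (polyToKhat E) g)

theorem det_polyGL (g : SL(2, PuiseuxPoly E)) :
    (polyGL g : Matrix (Fin 2) (Fin 2) (Khat E)).det = 1 :=
  (Matrix.SpecialLinearGroup.map (polyToKhat E) g).2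

theorem orbitProj_moebiusRep (g : SL(2, PuiseuxPoly E)) (x : Khat E × ℝ) :
    orbitProj E (Quotient.mk _ (moebiusRep (valHat E) (polyGL g) x)) =
      orbitProj E (Quotient.mk _ x) :=
  orbitProj_smul g (Quotient.mk _ x)

theorem orbitProj_eta_add (a : Khat E) (f : PuiseuxPoly E) (r : ℝ) :
    orbitProj E (eta (a + polyToKhat E f) r) = orbitProj E (eta a r) := by
  let g : SL(2, PuiseuxPoly E) := ⟨!![1, f; 0, 1], by simp [Matrix.det_fin_two]⟩
  have h : moebiusRep (valHat E) (polyGL g) (a, r) = (a + polyToKhat E f, r) :=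
    moebiusRep_translation _ (map_one (polyToKhat E)) rfl (map_zero (polyToKhat E))
      (map_one (polyToKhat E)) _
  have h' := orbitProj_moebiusRep g (a, r)
  rwa [h] at h'

variable (E) in
/-- The matrix of the inversion `z ↦ -1 / z`. -/
def inversion : SL(2, PuiseuxPoly E) := ⟨!![0, -1; 1, 0], by simp [Matrix.det_fin_two]⟩

theorem polyGL_inversion_zero_one : polyGL (inversion E) 0 1 = -1 :=
  (map_neg (polyToKhat E) 1).trans (congrArg Neg.neg (map_one (polyToKhat E)))

theorem orbitProj_eta_eq_of_le_valHat {a : Khat E} {r : ℝ} (h : (r : WithTop ℝ) ≤ valHat E a) :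
    orbitProj E (eta a r) = orbitProj E (eta 0 (-r)) := by
  have h' := orbitProj_moebiusRep (inversion E) (a, r)
  rw [moebiusRep_inversion_of_le _ (map_zero (polyToKhat E)) polyGL_inversion_zero_one
    (map_one (polyToKhat E)) (map_zero (polyToKhat E)) h] at h'
  exact h'.symm

theorem orbitProj_eta_eq_of_not_le_valHat {a : Khat E} {r : ℝ}
    (h : ¬ (r : WithTop ℝ) ≤ valHat E a) :
    orbitProj E (eta a r) = orbitProj E (eta (-1 / a) (r - 2 * realVal (valHat E) a)) := by
  have h' := orbitProj_moebiusRep (inversion E) (a, r)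
  rw [moebiusRep_inversion_of_not_le _ (map_zero (polyToKhat E)) polyGL_inversion_zero_one
    (map_one (polyToKhat E)) (map_zero (polyToKhat E)) h] at h'
  exact h'.symm

theorem exists_orbitProj_eq_of_le_valHat {a : Khat E} {r : ℝ} (h : (r : WithTop ℝ) ≤ valHat E a) :
    ∃ s ≤ 0, orbitProj E (eta a r) = orbitProj E (eta 0 s) := by
  rcases le_total r 0 with hr | hr
  · exact ⟨r, hr, by rw [eta_eq_eta (valHat E) (b := 0) (by simpa using h)]⟩
  · exact ⟨-r, by linarith, orbitProj_eta_eq_of_le_valHat h⟩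

theorem exists_orbitProj_eq_val_ge {n : ℕ+} {b : PuiseuxField E}
    (hb : (b : E⟦ℚ⟧) ∈ laurentRoot E n) :
    ∃ c : PuiseuxField E, (c : E⟦ℚ⟧) ∈ laurentRoot E n ∧
      ((1 / (n : ℕ) : ℝ) : WithTop ℝ) ≤ valHat E (c : Khat E) ∧
      ∀ r, orbitProj E (eta (b : Khat E) r) = orbitProj E (eta (c : Khat E) r) := by
  obtain ⟨f, hf', hf⟩ := exists_poly_sub_val_ge hb
  refine ⟨b - f, hf', hf, fun r => ?_⟩
  have e : (b : Khat E) = ((b - f : PuiseuxField E) : Khat E) + polyToKhat E f := by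
    change _ = _ + ((f : PuiseuxField E) : Khat E)
    rw [← UniformSpace.Completion.coe_add, sub_add_cancel]
  rw [e, orbitProj_eta_add]

/-- The continued fraction algorithm in `E((t ^ (-1/n)))`: after removal of the polynomial part, the
centre has valuation at least `1 / n`, so that the inversion either reaches the modular ray or
lowers the radius by at least `2 / n`. -/
theorem exists_orbitProj_eq_of_laurentRoot (n : ℕ+) (N : ℕ) (b : PuiseuxField E)
    (hb : (b : E⟦ℚ⟧) ∈ laurentRoot E n) (r : ℝ) (hr : r ≤ N * (1 / (n : ℕ))) :
    ∃ s ≤ 0, orbitProj E (eta (b : Khat E) r) = orbitProj E (eta 0 s) := by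
  have hn : (0 : ℝ) ≤ 1 / (n : ℕ) := by positivity
  induction N generalizing b r with
  | zero =>
    obtain ⟨c, -, hc, hbc⟩ := exists_orbitProj_eq_val_ge hb
    rw [hbc]
    refine exists_orbitProj_eq_of_le_valHat (le_trans (WithTop.coe_le_coe.2 ?_) hc)
    simp only [Nat.cast_zero, zero_mul] at hr
    linarith
  | succ M ih =>
    obtain ⟨c, hcn, hc, hbc⟩ := exists_orbitProj_eq_val_ge hb
    rw [hbc]
    by_cases hcr : (r : WithTop ℝ) ≤ valHat E c
    · exact exists_orbitProj_eq_of_le_valHat hcr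
    · have hc0 : (c : Khat E) ≠ 0 := by
        intro h
        simp [h] at hcr
      have e : -1 / (c : Khat E) = ((-c⁻¹ : PuiseuxField E) : Khat E) := by
        change _ = UniformSpace.Completion.coeRingHom (-c⁻¹)
        rw [map_neg, map_inv₀, neg_div, one_div]
        rfl
      rw [orbitProj_eta_eq_of_not_le_valHat hcr, e]
      refine ih _ (neg_mem (inv_mem hcn)) _ ?_
      rw [← coe_realVal _ hc0, WithTop.coe_le_coe] at hc
      push_cast at hr
      linarith

/-- Every orbit meets the modular ray: the centre of a ball may be moved to a Puiseux series, which
lies in some `E((t ^ (-1/n)))`. -/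
theorem exists_orbitProj_eq_eta_zero (o : OrbitSpace E) :
    ∃ s ≤ 0, o = orbitProj E (eta 0 s) := by
  obtain ⟨⟨a, r⟩⟩ := o
  obtain ⟨b, hb⟩ := exists_puiseux_close a r
  obtain ⟨n, hn⟩ := b.2
  obtain ⟨N, hN⟩ := exists_nat_ge (r / (1 / (n : ℕ)))
  have hpos : (0 : ℝ) < 1 / (n : ℕ) := by have := n.pos; positivity
  obtain ⟨s, hs, h⟩ := exists_orbitProj_eq_of_laurentRoot n N b hn r ((div_le_iff₀ hpos).1 hN)
  refine ⟨s, hs, ?_⟩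
  rw [← h, ← eta_eq_eta (valHat E) hb]
  rfl

end Reduction

/-! ### The height of an orbit -/

section Height

variable (E : Type*) [Field E]

/-- The nonzero pairs of Puiseux polynomials, as pairs of elements of the completed field. -/
def nonzeroPolyPairs : Set (Khat E × Khat E) :=
  {v | ∃ p q : PuiseuxPoly E, (p ≠ 0 ∨ q ≠ 0) ∧ v = (polyToKhat E p, polyToKhat E q)}

variable {E}

theorem normalizedValSet_eq_of_orbitProj_eq {x y : Khat E × ℝ}
    (h : orbitProj E (Quotient.mk _ x) = orbitProj E (Quotient.mk _ y)) :
    normalizedValSet (valHat E) (nonzeroPolyPairs E) x =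
      normalizedValSet (valHat E) (nonzeroPolyPairs E) y := by
  have key : ∀ {x y : Khat E × ℝ},
      orbitProj E (Quotient.mk _ x) = orbitProj E (Quotient.mk _ y) →
      normalizedValSet (valHat E) (nonzeroPolyPairs E) x ⊆
        normalizedValSet (valHat E) (nonzeroPolyPairs E) y := by
    intro x y h
    obtain ⟨g, hg⟩ := Quotient.exact (s := MulAction.orbitRel _ _) h
    have hxy := Quotient.exact (s := ballSetoid (valHat E)) hg
    rw [← normalizedValSet_congr _ hxy]
    refine normalizedValSet_moebiusRep_subset _ (det_polyGL g) ?_ y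
    rintro _ ⟨p, q, hpq, rfl⟩
    -- `(p, q) * g` is nonzero because `g` is invertible over the Puiseux polynomials.
    refine ⟨p * g 0 0 + q * g 1 0, p * g 0 1 + q * g 1 1, ?_, by simp only [map_add, map_mul]; rfl⟩
    have hdet : g 0 0 * g 1 1 - g 0 1 * g 1 0 = 1 := by
      rw [← Matrix.det_fin_two]; exact g.2
    contrapose! hpq
    obtain ⟨h1, h2⟩ := hpq
    constructor
    · linear_combination g 1 1 * h1 - g 1 0 * h2 - p * hdet
    · linear_combination g 0 0 * h2 - g 0 1 * h1 - q * hdet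
  exact (key h).antisymm (key h.symm)

/-- On the modular ray, the constant form `(0, 1)` attains the largest value: since nonzero Puiseux
polynomials have valuation at most `0`, and `r ≤ 0`, no form has a positive valuation. -/
theorem normalizedValSet_zero {r : ℝ} (hr : r ≤ 0) :
    normalizedValSet (valHat E) (nonzeroPolyPairs E) (0, r) = Set.Iic (-r / 2) := by
  ext m
  constructor
  · rintro ⟨_, ⟨p, q, hpq, rfl⟩, h⟩
    obtain ⟨h1, h2⟩ := le_min_iff.1 h
    simp only [mul_zero, zero_add] at h1 h2
    have h3 : ((m + r / 2 : ℝ) : WithTop ℝ) ≤ 0 := by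
      rcases hpq with hp | hq
      · refine h1.trans ?_
        exact add_nonpos (valHat_polyToKhat_nonpos hp) (WithTop.coe_le_coe.2 hr)
      · exact h2.trans (valHat_polyToKhat_nonpos hq)
    have h4 := WithTop.coe_le_coe.1 h3
    simp only [Set.mem_Iic]
    linarith
  · intro h
    refine ⟨_, ⟨0, 1, Or.inr one_ne_zero, rfl⟩, ?_⟩
    simp only [Set.mem_Iic] at h
    simp only [linRep, map_zero, map_one, AddValuation.map_zero, AddValuation.map_one,
      WithTop.top_add, zero_mul, zero_add]
    rw [min_eq_right le_top, ← WithTop.coe_zero, WithTop.coe_le_coe]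
    linarith

variable (E) in
/-- The parameter `s ≤ 0` of the point `η_{0,s}` of the modular ray that lies in a given orbit. -/
def orbitHeight (o : OrbitSpace E) : ℝ := (exists_orbitProj_eq_eta_zero o).choose

theorem orbitHeight_nonpos (o : OrbitSpace E) : orbitHeight E o ≤ 0 :=
  (exists_orbitProj_eq_eta_zero o).choose_spec.1

theorem orbitProj_eta_orbitHeight (o : OrbitSpace E) :
    orbitProj E (eta 0 (orbitHeight E o)) = o :=
  (exists_orbitProj_eq_eta_zero o).choose_spec.2.symm

theorem normalizedValSet_eq_Iic_orbitHeight (x : Khat E × ℝ) :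
    normalizedValSet (valHat E) (nonzeroPolyPairs E) x =
      Set.Iic (-orbitHeight E (orbitProj E (Quotient.mk _ x)) / 2) := by
  rw [← normalizedValSet_zero (E := E) (orbitHeight_nonpos _)]
  exact normalizedValSet_eq_of_orbitProj_eq (orbitProj_eta_orbitHeight _).symm

theorem orbitHeight_orbitProj_eta {r : ℝ} (hr : r ≤ 0) :
    orbitHeight E (orbitProj E (eta 0 r)) = r := by
  have h := (normalizedValSet_eq_Iic_orbitHeight ((0, r) : Khat E × ℝ)).symm.trans
    (normalizedValSet_zero hr)
  have h' : -orbitHeight E (orbitProj E (eta 0 r)) / 2 = -r / 2 := Set.Iic_injective h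
  linarith

/-- The height is `-2` times the supremum of `normalizedValSet`, so that it is `1`-Lipschitz. -/
theorem orbitHeight_sub_le_distRep (x y : Khat E × ℝ) :
    orbitHeight E (orbitProj E (Quotient.mk _ y)) - orbitHeight E (orbitProj E (Quotient.mk _ x)) ≤
      distRep (valHat E) x y := by
  have hx : -orbitHeight E (orbitProj E (Quotient.mk _ x)) / 2 ∈
      normalizedValSet (valHat E) (nonzeroPolyPairs E) x := by
    rw [normalizedValSet_eq_Iic_orbitHeight]
    exact Set.mem_Iic.2 le_rfl
  have h := sub_half_distRep_mem_normalizedValSet (valHat E) hx y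
  rw [normalizedValSet_eq_Iic_orbitHeight, Set.mem_Iic] at h
  linarith

theorem continuous_orbitHeight_metricTopology :
    @Continuous _ _ (metricTopology (valHat E)) _ fun η => orbitHeight E (orbitProj E η) := by
  let _ := berkMetric (valHat E)
  refine LipschitzWith.continuous (K := 1) (LipschitzWith.of_dist_le_mul ?_)
  rintro ⟨x⟩ ⟨y⟩
  rw [NNReal.coe_one, one_mul, Real.dist_eq, abs_sub_le_iff]
  refine ⟨?_, orbitHeight_sub_le_distRep x y⟩
  exact (orbitHeight_sub_le_distRep y x).trans_eq (distRep_comm _ _ _)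

end Height

/-! ### The homeomorphism -/

/-- The height is continuous for every topology at least as fine as that of the metric, and the
modular ray is continuously parametrized for every topology at most as fine as the quotient
topology. -/
theorem isHomeomorph_orbitProj_of_le {E : Type*} [Field E] [τ : TopologicalSpace (HBerk E)]
    (h₁ : quotientTopology (valHat E) ≤ τ) (h₂ : τ ≤ metricTopology (valHat E)) :
    IsHomeomorph (fun η : modularRay E => orbitProj E η) := by
  have hheight : Continuous (orbitHeight E) :=
    isQuotientMap_quotient_mk'.continuous_iff.2
      (continuous_le_dom h₂ continuous_orbitHeight_metricTopology)
  have heta : Continuous fun r : ℝ => (eta 0 r : HBerk E) :=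
    continuous_le_rng h₁ (continuous_eta_zero_quotientTopology _)
  refine isHomeomorph_iff_exists_inverse.2 ⟨continuous_quotient_mk'.comp continuous_subtype_val,
    fun o => ⟨eta 0 (orbitHeight E o), _, orbitHeight_nonpos o, rfl⟩, ?_,
    orbitProj_eta_orbitHeight, (heta.comp hheight).subtype_mk _⟩
  rintro ⟨_, r, hr, rfl⟩
  exact Subtype.ext (congrArg (eta 0) (orbitHeight_orbitProj_eta hr))

end PuiseuxRay

end

theorem mainTheorem6 (E : Type*) [Field E]
    [τ : TopologicalSpace (PuiseuxRay.HBerk E)]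
    (hτ : τ = PuiseuxRay.quotientTopology (PuiseuxRay.valHat E) ∨
      τ = PuiseuxRay.metricTopology (PuiseuxRay.valHat E)) :
    IsHomeomorph (fun η : PuiseuxRay.modularRay E => PuiseuxRay.orbitProj E η) := by
  have hle := PuiseuxRay.quotientTopology_le_metricTopology (PuiseuxRay.valHat E)
    PuiseuxRay.setOf_le_valHat_sub_mem_nhds
  rcases hτ with h | h
  · exact PuiseuxRay.isHomeomorph_orbitProj_of_le h.ge (h.le.trans hle)
  · exact PuiseuxRay.isHomeomorph_orbitProj_of_le (hle.trans h.ge) h.le
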